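/- Let $J=J(\{a_j\},\{b_j\},\{c_j\})_{j\in\mathbb{Z}}$ be a whole-line Jacobi matrix with uniformly bounded complex entries and $a_nc_n\ne0$, acting on $\ell^2(\mathbb{Z})$ by $(Ju)_n=a_{n-1}u_{n-1}+b_nu_n+c_nu_{n+1}$, and let $J_0=J(\{1\},\{0\},\{1\})$. Assume that $J-J_0$ is trace class. Then $$\Delta:=\sum_{n\in\mathbb{Z}}\bigl(|b_n|+|1-a_nc_n|\bigr)<\infty .$$ For $0<|z|<1$ put $\lambda(z)=z+1/z$; then $J_0-\lambda(z)$ is invertible, $(J-J_0)(J_0-\lambda(z))^{-1}$ is trace class, and the perturbation determinant is the Fredholm determinant $$L(z,J):=\det\bigl(I+(J-J_0)(J_0-\lambda(z))^{-1}\bigr).$$ At $z=0$, where $\lambda=\infty$, the resolvent is read as $0$. For every $z$ with $|z|<1$, with $x:=\dfrac{2|z|}{|1-z^2|}\bigl(\Delta^{1/2}+\Delta\bigr)$, $$|L(z,J)-1|\le(4x+5x^2)e^{4x},\qquad |L(z,J)|\le(1+4x+5x^2)e^{4x}\le e^{8x},$$ and consequently $$\log|L(z,J)|\le\frac{16|z|}{|1-z^2|}\bigl(\Delta^{1/2}+\Delta\bigr)$$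 (trivially so where $L(z,J)=0$). Moreover $L(0,J)=1$ and $L(z,J)\to1$ as $z\to0$. -/

import Mathlib

open Filter Topology

noncomputable section

/-- The complex Hilbert space `ℓ²(ℤ)`. -/
abbrev EllTwo : Type := lp (fun _ : ℤ => ℂ) 2

/-- For a bounded weight `w` and a shift `k`, the operator `(W u) n = w n * u (n + k)` maps
square-summable sequences to square-summable sequences, with `‖W u‖ ≤ C ‖u‖`. -/
theorem weightedShift_memℓp (w : ℤ → ℂ) (k : ℤ) (hw : ∃ C : ℝ, ∀ n, ‖w n‖ ≤ C) (u : EllTwo) :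
    Memℓp (fun n : ℤ => w n * u (n + k)) 2 := by
  obtain ⟨C, hC⟩ := hw
  have hu : Summable fun n : ℤ => ‖u n‖ ^ (2 : ENNReal).toReal :=
    (lp.memℓp u).summable (by norm_num)
  have hu' : Summable fun n : ℤ => C ^ (2 : ENNReal).toReal * ‖u (n + k)‖ ^ (2 : ENNReal).toReal :=
    (((Equiv.addRight k).summable_iff (f := fun n : ℤ => ‖u n‖ ^ (2 : ENNReal).toReal)).2
      hu).mul_left _
  have hC0 : 0 ≤ C := (norm_nonneg _).trans (hC 0)
  refine memℓp_gen (hu'.of_nonneg_of_le (fun n => by positivity) fun n => ?_)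
  rw [← Real.mul_rpow hC0 (norm_nonneg _), norm_mul]
  exact Real.rpow_le_rpow (by positivity)
    (mul_le_mul_of_nonneg_right (hC n) (norm_nonneg _)) (by norm_num)

/-- The bounded operator `(W u) n = w n * u (n + k)` on `ℓ²(ℤ)`, for a bounded weight `w`. -/
def weightedShift (w : ℤ → ℂ) (k : ℤ) (hw : ∃ C : ℝ, ∀ n, ‖w n‖ ≤ C) : EllTwo →L[ℂ] EllTwo :=
  LinearMap.mkContinuousOfExistsBound
    { toFun := fun u => ⟨fun n : ℤ => w n * u (n + k), weightedShift_memℓp w k hw u⟩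
      map_add' := fun u v => by
        ext n
        exact mul_add (w n) (u (n + k)) (v (n + k))
      map_smul' := fun r u => by
        ext n
        simp [mul_left_comm] }
    (by
      obtain ⟨C, hC⟩ := id hw
      have hC0 : 0 ≤ C := (norm_nonneg _).trans (hC 0)
      refine ⟨C, fun u => ?_⟩
      have h2 : 0 < (2 : ENNReal).toReal := by norm_num
      refine lp.norm_le_of_tsum_le h2 (by positivity) ?_
      have hu : Summable fun n : ℤ => ‖u n‖ ^ (2 : ENNReal).toReal := (lp.memℓp u).summable h2
      have hs := ((Equiv.addRight k).summable_iff
        (f := fun n : ℤ => ‖u n‖ ^ (2 : ENNReal).toReal)).2 hu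
      have ht := (Equiv.addRight k).tsum_eq (fun n : ℤ => ‖u n‖ ^ (2 : ENNReal).toReal)
      rw [Real.mul_rpow hC0 (norm_nonneg _), lp.norm_rpow_eq_tsum h2 u, ← ht, ← tsum_mul_left]
      refine Summable.tsum_le_tsum (fun n => ?_)
        ((weightedShift_memℓp w k hw u).summable h2) (hs.mul_left _)
      rw [← Real.mul_rpow hC0 (norm_nonneg _)]
      refine Real.rpow_le_rpow (norm_nonneg _) ?_ (by norm_num)
      simpa using mul_le_mul_of_nonneg_right (hC n) (norm_nonneg (u (n + k))))

@[simp]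
theorem weightedShift_apply (w : ℤ → ℂ) (k : ℤ) (hw : ∃ C : ℝ, ∀ n, ‖w n‖ ≤ C) (u : EllTwo)
    (n : ℤ) : weightedShift w k hw u n = w n * u (n + k) := rfl

/-- A whole-line Jacobi matrix: uniformly bounded complex sequences `a`, `b`, `c` over `ℤ`
with `a n * c n ≠ 0`. Row `n` has the entries `a (n - 1)`, `b n`, `c n` in the columns
`n - 1`, `n`, `n + 1`. -/
structure JacobiMatrix where
  a : ℤ → ℂ
  b : ℤ → ℂ
  c : ℤ → ℂ
  bounded_a : ∃ C : ℝ, ∀ n, ‖a n‖ ≤ C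
  bounded_b : ∃ C : ℝ, ∀ n, ‖b n‖ ≤ C
  bounded_c : ∃ C : ℝ, ∀ n, ‖c n‖ ≤ C
  mul_ne_zero : ∀ n, a n * c n ≠ 0

namespace JacobiMatrix

/-- The bounded operator on `ℓ²(ℤ)` given by a Jacobi matrix. -/
def toOp (J : JacobiMatrix) : EllTwo →L[ℂ] EllTwo :=
  weightedShift (fun n => J.a (n - 1)) (-1) (J.bounded_a.imp fun _ h n => h (n - 1))
    + weightedShift J.b 0 J.bounded_b + weightedShift J.c 1 J.bounded_c

theorem toOp_apply (J : JacobiMatrix) (u : EllTwo) (n : ℤ) :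
    J.toOp u n = J.a (n - 1) * u (n - 1) + J.b n * u n + J.c n * u (n + 1) := by
  simp [toOp, sub_eq_add_neg]

/-- The discrete Laplacian `J₀ = J({1}, {0}, {1})`. -/
def free : JacobiMatrix where
  a := fun _ => 1
  b := fun _ => 0
  c := fun _ => 1
  bounded_a := ⟨1, fun _ => by simp⟩
  bounded_b := ⟨0, fun _ => by simp⟩
  bounded_c := ⟨1, fun _ => by simp⟩
  mul_ne_zero := fun _ => by simp

/-- The `n`-th term `|b_n| + |1 - a_n c_n|` of the series `Δ`. -/
def deltaTerm (J : JacobiMatrix) (n : ℤ) : ℝ := ‖J.b n‖ + ‖1 - J.a n * J.c n‖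

/-- `Δ = ∑_{n ∈ ℤ} (|b_n| + |1 - a_n c_n|)`. -/
def delta (J : JacobiMatrix) : ℝ := ∑' n : ℤ, J.deltaTerm n

end JacobiMatrix

section Determinant

variable {H : Type*} [NormedAddCommGroup H] [InnerProductSpace ℂ H]

/-- Trace class (nuclear) operators on a Hilbert space:
`T = ∑ₙ ⟨y n, ·⟩ x n` with `∑ₙ ‖x n‖ ‖y n‖ < ∞`. -/
def IsTraceClass (T : H →L[ℂ] H) : Prop :=
  ∃ x y : ℕ → H, (Summable fun n => ‖x n‖ * ‖y n‖) ∧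
    ∀ u : H, HasSum (fun n => inner ℂ (y n) u • x n) (T u)

/-- The principal minor of `K` on the finite index set `S`, in the orthonormal basis `e`:
`det (⟨e i, K e j⟩)_{i, j ∈ S}`. -/
def principalMinor {ι : Type*} [DecidableEq ι] (e : HilbertBasis ι ℂ H) (K : H →L[ℂ] H)
    (S : Finset ι) : ℂ :=
  (Matrix.of fun i j : S => inner ℂ (e i) (K (e j))).det

/-- The Fredholm determinant `det (I + K) = ∑ₖ tr Λᵏ(K)` of a trace class operator `K`. The traces
are computed in the orthonormal bases `e i₁ ∧ ⋯ ∧ e iₖ` of the exterior powers, so that the series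
is the sum of all finite principal minors of the matrix of `K`
(the minor on the empty set is `1`). -/
def fredholmDet {ι : Type*} [DecidableEq ι] (e : HilbertBasis ι ℂ H) (K : H →L[ℂ] H) : ℂ :=
  ∑' S : Finset ι, principalMinor e K S

end Determinant

/-- The standard orthonormal basis of `ℓ²(ℤ)`. -/
def stdBasis : HilbertBasis ℤ ℂ EllTwo := HilbertBasis.ofRepr (LinearIsometryEquiv.refl ℂ EllTwo)

theorem stdBasis_apply (j : ℤ) : stdBasis j = lp.single 2 j (1 : ℂ) :=
  (stdBasis.repr_symm_single j).symm

theorem inner_stdBasis (i : ℤ) (u : EllTwo) : inner ℂ (stdBasis i) u = u i := by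
  rw [← HilbertBasis.repr_apply_apply]
  rfl

/-- The Zhukovsky function `λ(z) = z + 1/z` (used for `z ≠ 0`; it sends `0` to `∞`). -/
def zhukovsky (z : ℂ) : ℂ := z + 1 / z

open Classical in
/-- The resolvent `(J₀ - λ(z))⁻¹`; at `z = 0`, where `λ(z) = ∞`, it is the zero operator. -/
def freeResolvent (z : ℂ) : EllTwo →L[ℂ] EllTwo :=
  if z = 0 then 0 else Ring.inverse (JacobiMatrix.free.toOp - zhukovsky z • 1)

namespace JacobiMatrix

/-- The operator `(J - J₀)(J₀ - λ(z))⁻¹`. -/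
def perturbationOp (J : JacobiMatrix) (z : ℂ) : EllTwo →L[ℂ] EllTwo :=
  (J.toOp - free.toOp) * freeResolvent z

/-- The perturbation determinant `L(z, J) = det (I + (J - J₀)(J₀ - λ(z))⁻¹)`. -/
def perturbationDet (J : JacobiMatrix) (z : ℂ) : ℂ :=
  fredholmDet stdBasis (J.perturbationOp z)

/-- `x = 2|z| (Δ^{1/2} + Δ) / |1 - z²|`. -/
def xBound (J : JacobiMatrix) (z : ℂ) : ℝ :=
  2 * ‖z‖ / ‖1 - z ^ 2‖ * (√J.delta + J.delta)

end JacobiMatrix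

end

/-!
The determinant `L(z, J)` is estimated through its finite truncations, where it can be computed.

In the standard basis the free resolvent has the kernel `z ^ |i - j| / (z - 1 / z)`
(`freeResolvent_stdBasis`), so `(J - J₀)(J₀ - λ(z))⁻¹` has the explicit matrix `perturbationKernel`.
A finite determinant is at most the product of the `ℓ¹`-norms of its rows, and these are at most a
constant times `|a_{i-1} - 1| + |b_i| + |c_i - 1|`. The latter is summable because the generalised
diagonals of a trace class operator are summable. Hence the principal minors are summable, and
`L(z, J)` is the limit of the determinants of the truncations of `J` that agree with `J₀` outside
`[-N, N]` (`tendsto_tsum_minor_truncate`).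

For a truncated matrix the sum of the principal minors is the finite determinant `det (1 + K)` over
a window (`tsum_minor_eq_det`). On the window `1 + K` factors into a tridiagonal matrix, namely
`J - λ(z)` with a boundary term `z` in both corners, and the free kernel
(`one_add_perturbationKernel_window`). The leading minors of the tridiagonal matrix, normalised by
`(-z) ^ n`, satisfy
`q_{n+2} = (1 + z² - z b_{n+1}) q_{n+1} - z² a_n c_n q_n`
with free solution `q = 1`, and the determinant is `(q_{n+1} - z² q_n) / (1 - z²)` at the last site
(`det_one_add_window`). So only the products `a_n c_n` enter, although the trace class hypothesis
concerns `a` and `c` separately.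

Solving the recursion as a discrete Volterra equation, whose kernel `(1 - z ^ (2 m)) / (1 - z²)` is
at most `2 / |1 - z²|`, and applying Gronwall's inequality gives
`|L(z, J) - 1| ≤ (exp (2 |z| Δ / |1 - z²|) - 1) / 2` for the truncations, uniformly in `N`, hence
for `J` (`norm_recursion_sub_le`, `norm_tsum_minor_sub_one_le`). The stated estimates follow since
`2 |z| Δ / |1 - z²| ≤ x`.
-/

/-! ### Determinants of finite matrices -/

theorem Matrix.det_one_add_eq_sum_principal_minors {n R : Type*} [Fintype n] [DecidableEq n]
    [CommRing R] (A : Matrix n n R) :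
    (1 + A).det = ∑ s : Finset n, (A.submatrix (Subtype.val : s → n) Subtype.val).det := by
  have h := (Matrix.detRowAlternating (R := R) (n := n)).map_add_univ A.row (1 : Matrix n n R).row
  rw [add_comm]
  refine (congrArg Matrix.det ?_).trans (h.trans (Finset.sum_congr rfl fun s _ => ?_))
  · ext i j
    rw [Matrix.add_apply]
    rfl
  · exact Matrix.det_piecewise_one_eq_submatrix_det A s

/-- The permutation expansion bounds a determinant by the product of the row sums. -/
theorem Matrix.norm_det_le_prod_sum_norm {n : Type*} [Fintype n] [DecidableEq n]
    (A : Matrix n n ℂ) : ‖A.det‖ ≤ ∏ i, ∑ j, ‖A i j‖ := by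
  rw [← Matrix.det_transpose, Matrix.det_apply, Finset.prod_univ_sum]
  refine (norm_sum_le _ _).trans ?_
  have h : ∀ σ : Equiv.Perm n, ‖Equiv.Perm.sign σ • ∏ i, A.transpose (σ i) i‖
      = ∏ i, ‖A i (σ i)‖ := by
    intro σ
    rw [Units.smul_def, zsmul_eq_mul, norm_mul, norm_prod]
    rcases Int.units_eq_one_or (Equiv.Perm.sign σ) with h | h <;> simp [h]
  simp_rw [h]
  rw [← Finset.sum_image (f := fun g : n → n => ∏ i, ‖A i (g i)‖) (s := Finset.univ)
    (g := fun σ : Equiv.Perm n => (σ : n → n)) fun σ _ τ _ h => DFunLike.coe_injective h]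
  exact Finset.sum_le_sum_of_subset_of_nonneg (fun g _ => by simp) fun g _ _ => by positivity

/-- The entries of the tridiagonal matrix with diagonal `d`, superdiagonal `u` and subdiagonal
`l`. -/
def tridiagonal (d u l : ℕ → ℂ) (i j : ℕ) : ℂ :=
  if i = j then d i else if j = i + 1 then u i else if i = j + 1 then l j else 0

/-- The leading principal minor of order `n` of a tridiagonal matrix. -/
def continuant (d u l : ℕ → ℂ) (n : ℕ) : ℂ :=
  (Matrix.of fun i j : Fin n => tridiagonal d u l i j).det

theorem continuant_zero (d u l : ℕ → ℂ) : continuant d u l 0 = 1 := by simp [continuant]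

theorem continuant_one (d u l : ℕ → ℂ) : continuant d u l 1 = d 0 := by
  simp [continuant, tridiagonal]

/-- The three-term recursion of continuants, by Laplace expansion along the last row and the last
column. The off-diagonal entries enter through the products `u n * l n` only. -/
theorem continuant_add_two (d u l : ℕ → ℂ) (n : ℕ) :
    continuant d u l (n + 2) =
      d (n + 1) * continuant d u l (n + 1) - u n * l n * continuant d u l n := by
  have hminor : ((Matrix.of fun i j : Fin (n + 2) => tridiagonal d u l i j).submatrix
      (Fin.last (n + 1)).succAbove (Fin.last n).castSucc.succAbove).det
      = u n * continuant d u l n := by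
    rw [Matrix.det_succ_column _ (Fin.last n), Fin.sum_univ_castSucc, Finset.sum_eq_zero, zero_add]
    · have hsub : (((Matrix.of fun i j : Fin (n + 2) => tridiagonal d u l i j).submatrix
          (Fin.last (n + 1)).succAbove (Fin.last n).castSucc.succAbove).submatrix
          (Fin.last n).succAbove (Fin.last n).succAbove)
          = Matrix.of fun i j : Fin n => tridiagonal d u l i j := by
        ext i j
        have : (Fin.last n).castSucc.succAbove j.castSucc = j.castSucc.castSucc :=
          Fin.succAbove_of_castSucc_lt _ _ (by simp [Fin.lt_def])
        simp [this]
      rw [hsub]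
      simp [continuant, tridiagonal]
    · intro i _
      have hi : (i : ℕ) < n := i.2
      have h1 : (i : ℕ) ≠ n + 1 := by omega
      have h2 : (n : ℕ) ≠ i := by omega
      have h3 : (i : ℕ) ≠ n + 1 + 1 := by omega
      simp [tridiagonal, h1, h2, h3]
  rw [continuant, Matrix.det_succ_row _ (Fin.last (n + 1)), Fin.sum_univ_castSucc,
    Fin.sum_univ_castSucc, Finset.sum_eq_zero, zero_add, hminor]
  · have hsub : ((Matrix.of fun i j : Fin (n + 2) => tridiagonal d u l i j).submatrix
        (Fin.last (n + 1)).succAbove (Fin.last (n + 1)).succAbove)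
        = Matrix.of fun i j : Fin (n + 1) => tridiagonal d u l i j := by
      ext i j
      simp
    have hsign : (-1 : ℂ) ^ (n + 1 + n) = -1 := Odd.neg_one_pow ⟨n, by ring⟩
    rw [hsub]
    simp only [Fin.val_last, Fin.val_castSucc, Matrix.of_apply, hsign]
    have hl : tridiagonal d u l (n + 1) n = l n := by
      simp [tridiagonal, show n ≠ n + 1 + 1 by omega]
    have hd : tridiagonal d u l (n + 1) (n + 1) = d (n + 1) := by simp [tridiagonal]
    rw [hl, hd, Even.neg_one_pow ⟨n + 1, rfl⟩]
    simp only [continuant]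
    ring
  · intro j _
    have hj : (j : ℕ) < n := j.2
    have h1 : (n + 1 : ℕ) ≠ j := by omega
    have h2 : (j : ℕ) ≠ n + 1 + 1 := by omega
    have h3 : (n : ℕ) ≠ j := by omega
    simp [tridiagonal, h1, h2, h3]

theorem continuant_congr {d d' u l : ℕ → ℂ} {n : ℕ} (h : ∀ i < n, d i = d' i) :
    continuant d u l n = continuant d' u l n := by
  unfold continuant
  congr 1
  ext i j
  simp [tridiagonal, h i i.2]

/-- Changing the last diagonal entry changes a continuant by a multiple of the preceding one. -/
theorem continuant_add_last (d u l : ℕ → ℂ) (w : ℂ) (n : ℕ) :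
    continuant (fun i => d i + if i = n + 1 then w else 0) u l (n + 2)
      = continuant d u l (n + 2) + w * continuant d u l (n + 1) := by
  have h : ∀ m ≤ n + 1, continuant (fun i => d i + if i = n + 1 then w else 0) u l m
      = continuant d u l m := fun m hm =>
    continuant_congr fun i hi => by simp [show i ≠ n + 1 by omega]
  rw [continuant_add_two, continuant_add_two, h _ le_rfl, h _ n.le_succ]
  simp only [if_pos]
  ring

/-! ### The three-term recursion -/

theorem one_add_sum_mul_prod (w : ℕ → ℝ) (n : ℕ) :
    1 + ∑ k ∈ Finset.range n, w k * ∏ i ∈ Finset.range k, (1 + w i)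
      = ∏ i ∈ Finset.range n, (1 + w i) := by
  induction n with
  | zero => simp
  | succ n ih => rw [Finset.sum_range_succ, ← add_assoc, ih, Finset.prod_range_succ]; ring

/-- A discrete Gronwall inequality: the increments `f` bound `r`, and each `f k` is controlled by
the values of `r` up to `k`. -/
theorem le_prod_of_le_one_add_sum {r w : ℕ → ℝ} {f : ℕ → ℝ} (hw : ∀ k, 0 ≤ w k)
    (hr : ∀ n, r n ≤ 1 + ∑ k ∈ Finset.range n, f k)
    (hf : ∀ k, ∀ C, (∀ m ≤ k, r m ≤ C) → f k ≤ w k * C) (n : ℕ) :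
    f n ≤ w n * ∏ i ∈ Finset.range n, (1 + w i) := by
  have hmono : Monotone fun n => ∏ i ∈ Finset.range n, (1 + w i) := by
    refine monotone_nat_of_le_succ fun n => ?_
    rw [Finset.prod_range_succ]
    exact le_mul_of_one_le_right (Finset.prod_nonneg fun i _ => by linarith [hw i])
      (by linarith [hw n])
  induction n using Nat.strong_induction_on with
  | _ n ih =>
    refine hf n _ fun m hm => le_trans ?_ (hmono hm)
    refine (hr m).trans ?_
    beta_reduce
    rw [← one_add_sum_mul_prod]
    gcongr with k hk
    exact ih k (by have := Finset.mem_range.1 hk; omega)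

/-- The source term `δ_n` of the recursion
`q_{n+1} = (1 + z² - z β_n) q_n - z² γ_{n-1} q_{n-1}` written in the form
`q_{n+1} - q_n = z² (q_n - q_{n-1}) + δ_n`. It vanishes in the free case `β = 0`, `γ = 1`. -/
def sourceTerm (z : ℂ) (β γ q : ℕ → ℂ) : ℕ → ℂ
  | 0 => -z * β 0 * q 0
  | n + 1 => -z * β (n + 1) * q (n + 1) + z ^ 2 * (1 - γ n) * q n

/-- The size of the perturbation in the `n`-th step of the recursion; it bounds the coefficients of
`sourceTerm` up to the factor `‖z‖`. -/
noncomputable def sourceWeight (β γ : ℕ → ℂ) : ℕ → ℝ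
  | 0 => ‖β 0‖
  | n + 1 => ‖β (n + 1)‖ + ‖1 - γ n‖

theorem sourceWeight_nonneg (β γ : ℕ → ℂ) (n : ℕ) : 0 ≤ sourceWeight β γ n := by
  cases n <;> simp only [sourceWeight] <;> positivity

theorem sum_sourceWeight_le (β γ : ℕ → ℂ) (n : ℕ) :
    ∑ k ∈ Finset.range n, sourceWeight β γ k
      ≤ ∑ k ∈ Finset.range n, (‖β k‖ + ‖1 - γ k‖) := by
  have h : ∀ n, ∑ k ∈ Finset.range (n + 1), sourceWeight β γ k + ‖1 - γ n‖
      = ∑ k ∈ Finset.range (n + 1), (‖β k‖ + ‖1 - γ k‖) := by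
    intro n
    induction n with
    | zero => simp [sourceWeight]
    | succ n ih =>
      rw [Finset.sum_range_succ, Finset.sum_range_succ _ (n + 1), ← ih]
      simp only [sourceWeight]
      ring
  cases n with
  | zero => simp
  | succ n => linarith [h n, norm_nonneg (1 - γ n)]

section Recursion

variable {z : ℂ} {β γ q : ℕ → ℂ}

/-- The combination `q_{n+1} - z² q_n` is conserved up to the source terms. -/
theorem recursion_sub_eq (h0 : q 0 = 1) (h1 : q 1 = 1 - z * β 0)
    (h2 : ∀ n, q (n + 2) = (1 + z ^ 2 - z * β (n + 1)) * q (n + 1) - z ^ 2 * γ n * q n) (n : ℕ) :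
    q (n + 1) - z ^ 2 * q n = 1 - z ^ 2 + ∑ k ∈ Finset.range (n + 1), sourceTerm z β γ q k := by
  induction n with
  | zero => simp [sourceTerm, h0, h1]; ring
  | succ n ih =>
    rw [Finset.sum_range_succ, ← add_assoc, ← ih, h2]
    simp only [sourceTerm]
    ring

/-- The recursion as a discrete Volterra equation. Its kernel `1 - z ^ (2 (n - k))` is bounded by
`2` in the whole disc; bounds through `1 / (1 - ‖z‖ ^ 2)` would be too weak near the unit circle. -/
theorem recursion_volterra (h0 : q 0 = 1) (h1 : q 1 = 1 - z * β 0)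
    (h2 : ∀ n, q (n + 2) = (1 + z ^ 2 - z * β (n + 1)) * q (n + 1) - z ^ 2 * γ n * q n) (n : ℕ) :
    (1 - z ^ 2) * q n
      = 1 - z ^ 2 + ∑ k ∈ Finset.range n, (1 - (z ^ 2) ^ (n - k)) * sourceTerm z β γ q k := by
  induction n with
  | zero => simp [h0]
  | succ n ih =>
    have hs := recursion_sub_eq h0 h1 h2 n
    have hsum : ∑ k ∈ Finset.range (n + 1), (1 - (z ^ 2) ^ (n + 1 - k)) * sourceTerm z β γ q k
        = z ^ 2 * ∑ k ∈ Finset.range n, (1 - (z ^ 2) ^ (n - k)) * sourceTerm z β γ q k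
          + (1 - z ^ 2) * ∑ k ∈ Finset.range (n + 1), sourceTerm z β γ q k := by
      rw [Finset.sum_range_succ, Finset.sum_range_succ, mul_add, Finset.mul_sum, Finset.mul_sum,
        ← add_assoc, ← Finset.sum_add_distrib]
      congr 1
      · refine Finset.sum_congr rfl fun k hk => ?_
        rw [show n + 1 - k = n - k + 1 by have := Finset.mem_range.1 hk; omega]
        ring
      · rw [show n + 1 - n = 1 by omega, pow_one]
    rw [hsum]
    linear_combination z ^ 2 * ih + (1 - z ^ 2) * hs

/-- Gronwall's inequality applied to the Volterra equation bounds the source terms, whose sum is the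
deviation of `q_{n+1} - z² q_n` from its free value `1 - z²`. -/
theorem norm_recursion_sub_le (hz : ‖z‖ < 1) (h0 : q 0 = 1) (h1 : q 1 = 1 - z * β 0)
    (h2 : ∀ n, q (n + 2) = (1 + z ^ 2 - z * β (n + 1)) * q (n + 1) - z ^ 2 * γ n * q n) (n : ℕ) :
    ‖(q (n + 1) - z ^ 2 * q n) / (1 - z ^ 2) - 1‖
      ≤ (Real.exp (2 * (‖z‖ / ‖1 - z ^ 2‖)
          * ∑ k ∈ Finset.range (n + 1), sourceWeight β γ k) - 1) / 2 := by
  have hz2 : ‖z ^ 2‖ < 1 := by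
    rw [norm_pow]; exact pow_lt_one₀ (norm_nonneg _) hz two_ne_zero
  have hne : 1 - z ^ 2 ≠ 0 := fun h => by
    rw [← sub_eq_zero.1 h, norm_one] at hz2
    exact lt_irrefl _ hz2
  have hpos : 0 < ‖1 - z ^ 2‖ := norm_pos_iff.2 hne
  set M : ℝ := ‖z‖ / ‖1 - z ^ 2‖ with hM
  have hM0 : 0 ≤ M := by positivity
  set w : ℕ → ℝ := fun k => 2 * M * sourceWeight β γ k with hwdef
  have hw : ∀ k, 0 ≤ w k := fun k => mul_nonneg (by positivity) (sourceWeight_nonneg _ _ _)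
  have hq : ∀ n, ‖q n‖
      ≤ 1 + ∑ k ∈ Finset.range n, 2 * ‖sourceTerm z β γ q k‖ / ‖1 - z ^ 2‖ := by
    intro n
    have hv := congrArg norm (recursion_volterra h0 h1 h2 n)
    rw [norm_mul] at hv
    rw [← Finset.sum_div, ← mul_le_mul_iff_right₀ hpos, hv, mul_add, mul_one,
      mul_div_cancel₀ _ hpos.ne']
    refine (norm_add_le _ _).trans (add_le_add_right ((norm_sum_le _ _).trans ?_) _)
    refine Finset.sum_le_sum fun k _ => ?_
    rw [norm_mul]
    gcongr
    refine (norm_sub_le _ _).trans ?_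
    rw [norm_one, norm_pow]
    linarith [pow_le_one₀ (n := n - k) (norm_nonneg (z ^ 2)) hz2.le]
  have hf : ∀ k, ∀ C, (∀ m ≤ k, ‖q m‖ ≤ C) →
      2 * ‖sourceTerm z β γ q k‖ / ‖1 - z ^ 2‖ ≤ w k * C := by
    intro k C hC
    have hC0 : 0 ≤ C := (norm_nonneg _).trans (hC k le_rfl)
    have key : ‖sourceTerm z β γ q k‖ ≤ ‖z‖ * sourceWeight β γ k * C := by
      cases k with
      | zero =>
        simp only [sourceTerm, sourceWeight, norm_mul, norm_neg]
        gcongr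
        exact hC 0 le_rfl
      | succ k =>
        simp only [sourceTerm, sourceWeight]
        refine (norm_add_le _ _).trans ?_
        rw [mul_add, add_mul]
        simp only [norm_mul, norm_neg, norm_pow]
        gcongr
        · exact hC _ le_rfl
        · exact pow_le_of_le_one (norm_nonneg _) hz.le two_ne_zero
        · exact hC _ k.le_succ
    calc 2 * ‖sourceTerm z β γ q k‖ / ‖1 - z ^ 2‖
        ≤ 2 * (‖z‖ * sourceWeight β γ k * C) / ‖1 - z ^ 2‖ := by gcongr
      _ = w k * C := by simp only [hwdef, hM]; ring
  have hG := le_prod_of_le_one_add_sum hw hq hf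
  have hsub : (q (n + 1) - z ^ 2 * q n) / (1 - z ^ 2) - 1
      = (∑ k ∈ Finset.range (n + 1), sourceTerm z β γ q k) / (1 - z ^ 2) := by
    rw [recursion_sub_eq h0 h1 h2, add_div, div_self hne]
    ring
  rw [hsub, norm_div]
  have h3 : ‖∑ k ∈ Finset.range (n + 1), sourceTerm z β γ q k‖ / ‖1 - z ^ 2‖
      ≤ (∑ k ∈ Finset.range (n + 1), 2 * ‖sourceTerm z β γ q k‖ / ‖1 - z ^ 2‖) / 2 := by
    rw [← Finset.sum_div, ← Finset.mul_sum]
    have := norm_sum_le (Finset.range (n + 1)) (sourceTerm z β γ q)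
    calc _ ≤ (∑ k ∈ Finset.range (n + 1), ‖sourceTerm z β γ q k‖) / ‖1 - z ^ 2‖ := by gcongr
      _ = _ := by ring
  refine h3.trans ?_
  have h4 : ∑ k ∈ Finset.range (n + 1), 2 * ‖sourceTerm z β γ q k‖ / ‖1 - z ^ 2‖
      ≤ ∏ k ∈ Finset.range (n + 1), (1 + w k) - 1 := by
    rw [← one_add_sum_mul_prod]
    linarith [Finset.sum_le_sum fun k (_ : k ∈ Finset.range (n + 1)) => hG k]
  have h5 := Real.prod_one_add_le_exp_sum (Finset.range (n + 1)) (f := w) hw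
  rw [Finset.mul_sum]
  have h6 := h4.trans (sub_le_sub_right h5 1)
  simp only [hwdef] at h6
  linarith

end Recursion

/-! ### The free Green kernel -/

/-- The kernel `z ^ |i - j| / (z - 1 / z)` of the free resolvent `(J₀ - λ(z))⁻¹`. -/
noncomputable def freeKernel (z : ℂ) (i j : ℤ) : ℂ := z ^ (i - j).natAbs / (z - 1 / z)

theorem sub_one_div_ne_zero {z : ℂ} (hz : ‖z‖ < 1) (h0 : z ≠ 0) : z - 1 / z ≠ 0 := by
  intro h
  have h1 : z * z = 1 := by
    field_simp at h
    linear_combination h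
  have h2 := congrArg norm h1
  rw [norm_mul, norm_one] at h2
  nlinarith [norm_nonneg z]

theorem freeKernel_sub_one_of_le (z : ℂ) {i j : ℤ} (h : i ≤ j) :
    freeKernel z (i - 1) j = z * freeKernel z i j := by
  rw [freeKernel, freeKernel, show (i - 1 - j).natAbs = (i - j).natAbs + 1 by omega, pow_succ]
  ring

theorem freeKernel_add_one_of_le (z : ℂ) {i j : ℤ} (h : j ≤ i) :
    freeKernel z (i + 1) j = z * freeKernel z i j := by
  rw [freeKernel, freeKernel, show (i + 1 - j).natAbs = (i - j).natAbs + 1 by omega, pow_succ]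
  ring

/-- The columns of the free kernel solve `(J₀ - λ(z)) u = δ_j`. -/
theorem freeKernel_sub_add {z : ℂ} (hz : ‖z‖ < 1) (h0 : z ≠ 0) (i j : ℤ) :
    freeKernel z (i - 1) j + freeKernel z (i + 1) j - zhukovsky z * freeKernel z i j
      = if i = j then 1 else 0 := by
  have hne := sub_one_div_ne_zero hz h0
  rcases lt_trichotomy i j with h | h | h
  · rw [if_neg h.ne, freeKernel_sub_one_of_le z h.le]
    have h1 : freeKernel z i j = z * freeKernel z (i + 1) j := by
      rw [← freeKernel_sub_one_of_le z (by omega : i + 1 ≤ j), add_sub_cancel_right]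
    rw [h1, zhukovsky]
    field_simp
    ring
  · subst h
    rw [if_pos rfl, freeKernel_sub_one_of_le z le_rfl, freeKernel_add_one_of_le z le_rfl]
    have h1 : freeKernel z i i * (z - 1 / z) = 1 := by
      rw [freeKernel, div_mul_cancel₀ _ hne]
      simp
    rw [zhukovsky]
    linear_combination h1
  · rw [if_neg h.ne', freeKernel_add_one_of_le z h.le]
    have h1 : freeKernel z i j = z * freeKernel z (i - 1) j := by
      rw [← freeKernel_add_one_of_le z (by omega : j ≤ i - 1), sub_add_cancel]
    rw [h1, zhukovsky]
    field_simp
    ring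

theorem summable_pow_natAbs {r : ℝ} (hr : 0 ≤ r) (hr1 : r < 1) :
    Summable fun n : ℤ => r ^ n.natAbs := by
  have h := summable_geometric_of_lt_one hr hr1
  exact Summable.of_nat_of_neg (by simpa using h) (by simpa using h)

/-- The common `ℓ¹`-norm of the rows of the free kernel. -/
noncomputable def freeKernelRowSum (z : ℂ) : ℝ :=
  ∑' n : ℤ, ‖z‖ ^ n.natAbs / ‖z - 1 / z‖

theorem freeKernelRowSum_nonneg (z : ℂ) : 0 ≤ freeKernelRowSum z :=
  tsum_nonneg fun _ => by positivity

theorem sum_norm_freeKernel_le {z : ℂ} (hz : ‖z‖ < 1) (i : ℤ) (S : Finset ℤ) :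
    ∑ j ∈ S, ‖freeKernel z i j‖ ≤ freeKernelRowSum z := by
  have hs : Summable fun n : ℤ => ‖z‖ ^ n.natAbs / ‖z - 1 / z‖ :=
    (summable_pow_natAbs (norm_nonneg z) hz).div_const _
  have he := (Equiv.subLeft i).tsum_eq fun n : ℤ => ‖z‖ ^ n.natAbs / ‖z - 1 / z‖
  rw [freeKernelRowSum, ← he]
  simp only [freeKernel, norm_div, norm_pow]
  exact ((Equiv.subLeft i).summable_iff.2 hs).sum_le_tsum S fun _ _ => by simp; positivity

/-! ### Principal minors of the perturbation kernel -/

/-- The matrix of `(J - J₀)(J₀ - λ(z))⁻¹` in the standard basis, where `J = J(a, b, c)`. -/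
noncomputable def perturbationKernel (a b c : ℤ → ℂ) (z : ℂ) : Matrix ℤ ℤ ℂ := fun i j =>
  (a (i - 1) - 1) * freeKernel z (i - 1) j + b i * freeKernel z i j
    + (c i - 1) * freeKernel z (i + 1) j

/-- The `ℓ¹`-norm of the `i`-th row of `J - J₀`. -/
noncomputable def rowWeight (a b c : ℤ → ℂ) (i : ℤ) : ℝ := ‖a (i - 1) - 1‖ + ‖b i‖ + ‖c i - 1‖

theorem rowWeight_nonneg (a b c : ℤ → ℂ) (i : ℤ) : 0 ≤ rowWeight a b c i := by
  unfold rowWeight; positivity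

theorem sum_norm_perturbationKernel_le (a b c : ℤ → ℂ) {z : ℂ} (hz : ‖z‖ < 1) (i : ℤ)
    (S : Finset ℤ) :
    ∑ j ∈ S, ‖perturbationKernel a b c z i j‖ ≤ freeKernelRowSum z * rowWeight a b c i := by
  calc ∑ j ∈ S, ‖perturbationKernel a b c z i j‖
      ≤ ∑ j ∈ S, (‖a (i - 1) - 1‖ * ‖freeKernel z (i - 1) j‖ + ‖b i‖ * ‖freeKernel z i j‖
          + ‖c i - 1‖ * ‖freeKernel z (i + 1) j‖) := by
        refine Finset.sum_le_sum fun j _ => ?_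
        simp only [perturbationKernel, ← norm_mul]
        exact norm_add₃_le
    _ = ‖a (i - 1) - 1‖ * ∑ j ∈ S, ‖freeKernel z (i - 1) j‖
          + ‖b i‖ * ∑ j ∈ S, ‖freeKernel z i j‖
          + ‖c i - 1‖ * ∑ j ∈ S, ‖freeKernel z (i + 1) j‖ := by
        simp only [Finset.sum_add_distrib, Finset.mul_sum]
    _ ≤ ‖a (i - 1) - 1‖ * freeKernelRowSum z + ‖b i‖ * freeKernelRowSum z
          + ‖c i - 1‖ * freeKernelRowSum z := by
        gcongr <;> exact sum_norm_freeKernel_le hz _ _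
    _ = freeKernelRowSum z * rowWeight a b c i := by rw [rowWeight]; ring

/-- A crude bound, degenerating as `‖z‖ → 1`; it serves for summability and as a dominating
family. -/
theorem norm_minor_perturbationKernel_le (a b c : ℤ → ℂ) {z : ℂ} (hz : ‖z‖ < 1) (S : Finset ℤ) :
    ‖((perturbationKernel a b c z).submatrix (Subtype.val : S → ℤ) Subtype.val).det‖
      ≤ ∏ i ∈ S, freeKernelRowSum z * rowWeight a b c i := by
  refine (Matrix.norm_det_le_prod_sum_norm _).trans ?_
  rw [← Finset.prod_coe_sort S]
  refine Finset.prod_le_prod (fun _ _ => by positivity) fun i _ => ?_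
  simp only [Matrix.submatrix_apply]
  rw [Finset.sum_coe_sort S fun j => ‖perturbationKernel a b c z i j‖]
  exact sum_norm_perturbationKernel_le a b c hz i S

theorem summable_prod_rowWeight {a b c : ℤ → ℂ} (z : ℂ) (h : Summable (rowWeight a b c)) :
    Summable fun S : Finset ℤ => ∏ i ∈ S, freeKernelRowSum z * rowWeight a b c i :=
  summable_finsetProd_of_summable_nonneg
    (fun i => mul_nonneg (freeKernelRowSum_nonneg z) (rowWeight_nonneg a b c i)) (h.mul_left _)

/-- If only the rows of `K` in the image of `e` are nonzero, the sum of the principal minors of `K`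
is a finite determinant. -/
theorem tsum_minor_eq_det {n : ℕ} (e : Fin n ↪ ℤ) (K : Matrix ℤ ℤ ℂ)
    (hK : ∀ i, i ∉ Set.range e → ∀ j, K i j = 0) :
    ∑' S : Finset ℤ, (K.submatrix (Subtype.val : S → ℤ) Subtype.val).det
      = (1 + K.submatrix e e).det := by
  rw [Matrix.det_one_add_eq_sum_principal_minors,
    tsum_eq_sum (s := Finset.univ.map (Finset.mapEmbedding e).toEmbedding)]
  · rw [Finset.sum_map]
    refine Finset.sum_congr rfl fun s _ => ?_
    change (K.submatrix (Subtype.val : ↥(s.map e) → ℤ) Subtype.val).det = _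
    rw [← Matrix.det_submatrix_equiv_self (Finset.equivMap e s)]
    rfl
  · intro S hS
    have : ∃ i ∈ S, i ∉ Set.range e := by
      by_contra! h
      refine hS (Finset.mem_map.2 ⟨S.preimage e e.injective.injOn, Finset.mem_univ _, ?_⟩)
      ext i
      simp only [RelEmbedding.coe_toEmbedding, Finset.mapEmbedding_apply, Finset.mem_map,
        Finset.mem_preimage]
      constructor
      · rintro ⟨k, hk, rfl⟩
        exact hk
      · intro hi
        obtain ⟨k, rfl⟩ := h i hi
        exact ⟨k, hi, rfl⟩
    obtain ⟨i, hi, hie⟩ := this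
    exact Matrix.det_eq_zero_of_row_eq_zero ⟨i, hi⟩ fun j => hK i hie j

/-! ### Perturbations supported in a finite window -/

/-- The action of a finite tridiagonal matrix: the neighbours outside the window drop out. -/
theorem sum_tridiagonal_mul (d u l : ℕ → ℂ) (g : ℤ → ℂ) (m : ℤ) (k i : ℕ) (hi : i < k + 2) :
    ∑ x : Fin (k + 2), tridiagonal d u l i x * g (m + (x : ℕ))
      = (if i = 0 then 0 else l (i - 1) * g (m + i - 1)) + d i * g (m + i)
        + (if i = k + 1 then 0 else u i * g (m + i + 1)) := by
  rw [Fin.sum_univ_eq_sum_range fun x => tridiagonal d u l i x * g (m + (x : ℕ))]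
  have h : ∀ x : ℕ, tridiagonal d u l i x * g (m + (x : ℕ))
      = (if i - 1 = x then (if i = 0 then 0 else l (i - 1) * g (m + i - 1)) else 0)
        + (if i = x then d i * g (m + i) else 0)
        + (if i + 1 = x then u i * g (m + i + 1) else 0) := by
    intro x
    unfold tridiagonal
    rcases lt_trichotomy i x with hx | rfl | hx
    · rw [if_neg hx.ne, if_neg (show i ≠ x + 1 by omega), if_neg (show i - 1 ≠ x by omega),
        if_neg hx.ne]
      by_cases h1 : x = i + 1
      · subst h1
        simp [add_assoc]
      · simp [h1, Ne.symm h1]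
    · rcases i with _ | i <;> simp
    · rw [if_neg hx.ne', if_neg (show x ≠ i + 1 by omega), if_neg hx.ne',
        if_neg (show i + 1 ≠ x by omega)]
      by_cases h1 : i = x + 1
      · subst h1
        simp [add_sub_assoc]
      · simp [h1, show i - 1 ≠ x by omega]
  simp only [h, Finset.sum_add_distrib, Finset.sum_ite_eq, Finset.mem_range]
  rw [if_pos (show i - 1 < k + 2 by omega), if_pos hi]
  congr 1
  by_cases h1 : i = k + 1
  · simp [h1]
  · rw [if_neg h1, if_pos (by omega)]

/-- The diagonal of `J - λ(z)` on the window starting at `m`, with a boundary term `z` at the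
left end. It replaces the neighbour outside the window, as `freeKernel z (i - 1) j` is
`z * freeKernel z i j` for `i ≤ j`. -/
noncomputable def windowDiagonal (b : ℤ → ℂ) (z : ℂ) (m : ℤ) (n : ℕ) : ℂ :=
  b (m + n) - zhukovsky z + if n = 0 then z else 0

/-- On a window outside which `J` couples as `J₀` does, `1 + (J - J₀)(J₀ - λ(z))⁻¹` is the product
of `J - λ(z)`, with a boundary term `z` in both corners, and the free kernel. -/
theorem one_add_perturbationKernel_window {z : ℂ} (hz : ‖z‖ < 1) (h0 : z ≠ 0) (a b c : ℤ → ℂ)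
    (m : ℤ) (k : ℕ) (ha : a (m - 1) = 1) (hc : c (m + (k + 1 : ℕ)) = 1) :
    1 + (perturbationKernel a b c z).submatrix (fun i : Fin (k + 2) => m + (i : ℕ))
        (fun i : Fin (k + 2) => m + (i : ℕ))
      = (Matrix.of fun i j : Fin (k + 2) => tridiagonal
          (fun n => windowDiagonal b z m n + if n = k + 1 then z else 0)
          (fun n => c (m + n)) (fun n => a (m + n)) i j)
        * Matrix.of fun i j : Fin (k + 2) => freeKernel z (m + (i : ℕ)) (m + (j : ℕ)) := by
  ext i j
  rw [Matrix.mul_apply]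
  simp only [Matrix.of_apply]
  rw [sum_tridiagonal_mul _ _ _ (fun x => freeKernel z x (m + (j : ℕ))) m k i i.2,
    Matrix.add_apply, Matrix.submatrix_apply, Matrix.one_apply]
  have hG := freeKernel_sub_add hz h0 (m + (i : ℕ)) (m + (j : ℕ))
  have hij : (m + (i : ℕ) = m + (j : ℕ)) ↔ i = j := by
    rw [add_right_inj, Nat.cast_inj, Fin.val_inj]
  rw [if_congr hij rfl rfl] at hG
  rw [← hG, perturbationKernel]
  have hleft : (if (i : ℕ) = 0 then 0 else
        a (m + ((i : ℕ) - 1 : ℕ)) * freeKernel z (m + (i : ℕ) - 1) (m + (j : ℕ)))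
      + (if (i : ℕ) = 0 then z else 0) * freeKernel z (m + (i : ℕ)) (m + (j : ℕ))
      = a (m + (i : ℕ) - 1) * freeKernel z (m + (i : ℕ) - 1) (m + (j : ℕ)) := by
    by_cases h : (i : ℕ) = 0
    · rw [if_pos h, if_pos h, freeKernel_sub_one_of_le z (by omega), h]
      simp [ha]
    · rw [if_neg h, if_neg h, show m + ((i : ℕ) - 1 : ℕ) = m + (i : ℕ) - 1 by omega]
      ring
  have hright : (if (i : ℕ) = k + 1 then 0 else
        c (m + (i : ℕ)) * freeKernel z (m + (i : ℕ) + 1) (m + (j : ℕ)))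
      + (if (i : ℕ) = k + 1 then z else 0) * freeKernel z (m + (i : ℕ)) (m + (j : ℕ))
      = c (m + (i : ℕ)) * freeKernel z (m + (i : ℕ) + 1) (m + (j : ℕ)) := by
    by_cases h : (i : ℕ) = k + 1
    · have hj := j.2
      rw [if_pos h, if_pos h, freeKernel_add_one_of_le z (by omega), h, hc]
      ring
    · rw [if_neg h, if_neg h]
      ring
  rw [windowDiagonal]
  linear_combination -hleft - hright

/-- The continuants of the window, normalised so that they are all `1` in the free case. -/
noncomputable def windowSolution (a b c : ℤ → ℂ) (z : ℂ) (m : ℤ) (n : ℕ) : ℂ :=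
  (-z) ^ n * continuant (windowDiagonal b z m) (fun n => c (m + n)) (fun n => a (m + n)) n

section WindowSolution

variable {z : ℂ} (a b c : ℤ → ℂ) (m : ℤ)

theorem windowSolution_zero : windowSolution a b c z m 0 = 1 := by
  simp [windowSolution, continuant_zero]

theorem windowSolution_one (h0 : z ≠ 0) :
    windowSolution a b c z m 1 = 1 - z * b (m + (0 : ℕ)) := by
  simp only [windowSolution, continuant_one, windowDiagonal, zhukovsky, if_pos]
  field_simp
  ring

theorem windowSolution_add_two (h0 : z ≠ 0) (n : ℕ) :
    windowSolution a b c z m (n + 2)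
      = (1 + z ^ 2 - z * b (m + (n + 1 : ℕ))) * windowSolution a b c z m (n + 1)
        - z ^ 2 * (a (m + n) * c (m + n)) * windowSolution a b c z m n := by
  simp only [windowSolution, continuant_add_two, windowDiagonal, zhukovsky, Nat.succ_ne_zero,
    if_false]
  have h1 : (z : ℂ) * (1 / z) = 1 := mul_one_div_cancel h0
  linear_combination (-z) ^ (n + 1) * continuant (windowDiagonal b z m) (fun n => c (m + n))
    (fun n => a (m + n)) (n + 1) * h1

/-- The boundary term `z` at the right end of the window turns the last continuant into the
conserved combination of the recursion. -/
theorem pow_mul_continuant_corner (k : ℕ) :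
    (-z) ^ (k + 2) * continuant (fun n => windowDiagonal b z m n + if n = k + 1 then z else 0)
        (fun n => c (m + n)) (fun n => a (m + n)) (k + 2)
      = windowSolution a b c z m (k + 1 + 1) - z ^ 2 * windowSolution a b c z m (k + 1) := by
  rw [continuant_add_last, windowSolution, windowSolution]
  ring

end WindowSolution

/-- The perturbation determinant of a finitely supported perturbation is a normalised continuant.
In particular it depends on `a` and `c` through their product only. -/
theorem det_one_add_window {z : ℂ} (hz : ‖z‖ < 1) (h0 : z ≠ 0) (a b c : ℤ → ℂ)
    (m : ℤ) (k : ℕ) (ha : a (m - 1) = 1) (hc : c (m + (k + 1 : ℕ)) = 1) :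
    (1 + (perturbationKernel a b c z).submatrix (fun i : Fin (k + 2) => m + (i : ℕ))
        (fun i : Fin (k + 2) => m + (i : ℕ))).det
      = (windowSolution a b c z m (k + 1 + 1) - z ^ 2 * windowSolution a b c z m (k + 1))
          / (1 - z ^ 2) := by
  have hpow : (-z) ^ (k + 2) ≠ 0 := pow_ne_zero _ (neg_ne_zero.2 h0)
  set g := (Matrix.of fun i j : Fin (k + 2) => freeKernel z (m + (i : ℕ)) (m + (j : ℕ))).det
    with hg
  have key : ∀ a b c : ℤ → ℂ, a (m - 1) = 1 → c (m + (k + 1 : ℕ)) = 1 →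
      (-z) ^ (k + 2) * (1 + (perturbationKernel a b c z).submatrix
        (fun i : Fin (k + 2) => m + (i : ℕ)) (fun i : Fin (k + 2) => m + (i : ℕ))).det
      = (windowSolution a b c z m (k + 1 + 1) - z ^ 2 * windowSolution a b c z m (k + 1)) * g := by
    intro a b c ha hc
    rw [one_add_perturbationKernel_window hz h0 a b c m k ha hc, Matrix.det_mul,
      ← pow_mul_continuant_corner, hg, mul_assoc]
    rfl
  -- The free case determines the determinant `g` of the free kernel on the window.
  have hfree := key (fun _ => 1) (fun _ => 0) (fun _ => 1) rfl rfl
  have hK : perturbationKernel (fun _ => 1) (fun _ => 0) (fun _ => 1) z = 0 := by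
    ext i j
    simp [perturbationKernel]
  have hsrc : ∀ q : ℕ → ℂ, ∀ n, sourceTerm z (fun _ => 0) (fun _ => 1) q n = 0 := by
    intro q n
    cases n <;> simp [sourceTerm]
  have hs := recursion_sub_eq (z := z) (β := fun _ => 0) (γ := fun _ => 1)
    (windowSolution_zero (z := z) (fun _ => 1) (fun _ => 0) (fun _ => 1) m)
    (windowSolution_one _ _ _ m h0)
    (fun n => by rw [windowSolution_add_two _ _ _ m h0, mul_one]) (k + 1)
  rw [Finset.sum_eq_zero fun n _ => hsrc _ n, add_zero] at hs
  rw [hs, hK] at hfree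
  simp only [Matrix.submatrix_zero, Pi.zero_apply, add_zero, Matrix.det_one, mul_one] at hfree
  have hne : 1 - z ^ 2 ≠ 0 := fun h => hpow (by rw [hfree, h, zero_mul])
  rw [eq_div_iff hne]
  apply mul_left_cancel₀ hpow
  rw [← mul_assoc, key a b c ha hc, hfree]
  ring

/-! ### Truncation -/

/-- The sequence `f`, replaced by the constant `d` outside `[-N, N]`. -/
def truncate (f : ℤ → ℂ) (d : ℂ) (N : ℕ) (n : ℤ) : ℂ := if n.natAbs ≤ N then f n else d

theorem truncate_eq_of_le (f : ℤ → ℂ) (d : ℂ) {N : ℕ} {n : ℤ} (h : n.natAbs ≤ N) :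
    truncate f d N n = f n := if_pos h

theorem truncate_eq_of_lt (f : ℤ → ℂ) (d : ℂ) {N : ℕ} {n : ℤ} (h : N < n.natAbs) :
    truncate f d N n = d := if_neg h.not_ge

theorem norm_truncate_sub_le (f : ℤ → ℂ) (d : ℂ) (N : ℕ) (n : ℤ) :
    ‖truncate f d N n - d‖ ≤ ‖f n - d‖ := by
  unfold truncate
  split_ifs <;> simp

theorem rowWeight_truncate_le (a b c : ℤ → ℂ) (N : ℕ) (i : ℤ) :
    rowWeight (truncate a 1 N) (truncate b 0 N) (truncate c 1 N) i ≤ rowWeight a b c i := by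
  have hb := norm_truncate_sub_le b 0 N i
  simp only [sub_zero] at hb
  exact add_le_add (add_le_add (norm_truncate_sub_le a 1 N _) hb) (norm_truncate_sub_le c 1 N i)

theorem deltaTerm_truncate_le (a b c : ℤ → ℂ) (N : ℕ) (n : ℤ) :
    ‖truncate b 0 N n‖ + ‖1 - truncate a 1 N n * truncate c 1 N n‖
      ≤ ‖b n‖ + ‖1 - a n * c n‖ := by
  unfold truncate
  split_ifs
  · exact le_rfl
  · simp only [mul_one, sub_self, norm_zero, add_zero]
    positivity

/-- All nonzero rows of the truncated perturbation lie in the window `[-N, N + 1]`, which has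
`2 * N + 2` sites. -/
theorem tsum_minor_truncate_eq {z : ℂ} (hz : ‖z‖ < 1) (h0 : z ≠ 0) (a b c : ℤ → ℂ) (N : ℕ) :
    ∑' S : Finset ℤ, ((perturbationKernel (truncate a 1 N) (truncate b 0 N) (truncate c 1 N)
        z).submatrix (Subtype.val : S → ℤ) Subtype.val).det
      = (windowSolution (truncate a 1 N) (truncate b 0 N) (truncate c 1 N) z (-N) (2 * N + 1 + 1)
          - z ^ 2 * windowSolution (truncate a 1 N) (truncate b 0 N) (truncate c 1 N) z (-N)
            (2 * N + 1)) / (1 - z ^ 2) := by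
  let e : Fin (2 * N + 2) ↪ ℤ := ⟨fun i => -N + (i : ℕ), fun i j h => by
    simpa [Fin.val_inj] using h⟩
  rw [tsum_minor_eq_det e]
  · exact det_one_add_window hz h0 _ _ _ (-N) (2 * N) (truncate_eq_of_lt _ _ (by omega))
      (truncate_eq_of_lt _ _ (by omega))
  · intro i hi j
    have hi' : ¬ (-(N : ℤ) ≤ i ∧ i ≤ N + 1) := fun h =>
      hi ⟨⟨(i + N).toNat, by omega⟩, show -(N : ℤ) + ((i + N).toNat : ℕ) = i by omega⟩
    rw [perturbationKernel, truncate_eq_of_lt a 1 (by omega), truncate_eq_of_lt b 0 (by omega),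
      truncate_eq_of_lt c 1 (by omega)]
    simp

/-- The bound for truncated perturbations; it is uniform in the truncation. -/
theorem norm_tsum_minor_truncate_sub_one_le {z : ℂ} (hz : ‖z‖ < 1) (h0 : z ≠ 0) (a b c : ℤ → ℂ)
    (hD : Summable fun n => ‖b n‖ + ‖1 - a n * c n‖) (N : ℕ) :
    ‖∑' S : Finset ℤ, ((perturbationKernel (truncate a 1 N) (truncate b 0 N) (truncate c 1 N)
        z).submatrix (Subtype.val : S → ℤ) Subtype.val).det - 1‖
      ≤ (Real.exp (2 * (‖z‖ / ‖1 - z ^ 2‖) * ∑' n, (‖b n‖ + ‖1 - a n * c n‖)) - 1) / 2 := by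
  rw [tsum_minor_truncate_eq hz h0]
  refine (norm_recursion_sub_le hz
    (β := fun n => truncate b 0 N (-N + (n : ℕ)))
    (γ := fun n => truncate a 1 N (-N + (n : ℕ)) * truncate c 1 N (-N + (n : ℕ)))
    (windowSolution_zero _ _ _ _) (windowSolution_one _ _ _ _ h0)
    (windowSolution_add_two _ _ _ _ h0) (2 * N + 1)).trans ?_
  gcongr
  refine (sum_sourceWeight_le _ _ _).trans ?_
  refine (Finset.sum_le_sum fun n _ => deltaTerm_truncate_le a b c N (-N + (n : ℕ))).trans ?_
  have hinj : Function.Injective fun n : ℕ => -(N : ℤ) + n := fun i j h => by simpa using h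
  rw [← Finset.sum_image (g := fun n : ℕ => -(N : ℤ) + n)
    (f := fun n => ‖b n‖ + ‖1 - a n * c n‖) fun i _ j _ h => hinj h]
  exact hD.sum_le_tsum _ fun _ _ => by positivity

theorem summable_minor_perturbationKernel {z : ℂ} (hz : ‖z‖ < 1) {a b c : ℤ → ℂ}
    (h : Summable (rowWeight a b c)) :
    Summable fun S : Finset ℤ =>
      ((perturbationKernel a b c z).submatrix (Subtype.val : S → ℤ) Subtype.val).det :=
  (summable_prod_rowWeight z h).of_norm_bounded (norm_minor_perturbationKernel_le a b c hz)

/-- The minors of the truncated perturbation are eventually constant in `N` and dominated by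
products of the row weights of the full one. -/
theorem tendsto_tsum_minor_truncate {z : ℂ} (hz : ‖z‖ < 1) {a b c : ℤ → ℂ}
    (h : Summable (rowWeight a b c)) :
    Tendsto (fun N : ℕ => ∑' S : Finset ℤ,
        ((perturbationKernel (truncate a 1 N) (truncate b 0 N) (truncate c 1 N)
          z).submatrix (Subtype.val : S → ℤ) Subtype.val).det) atTop
      (𝓝 (∑' S : Finset ℤ,
        ((perturbationKernel a b c z).submatrix (Subtype.val : S → ℤ) Subtype.val).det)) := by
  refine tendsto_tsum_of_dominated_convergence (summable_prod_rowWeight z h) (fun S => ?_)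
    (Eventually.of_forall fun N S => (norm_minor_perturbationKernel_le _ _ _ hz S).trans ?_)
  · refine tendsto_const_nhds.congr' ?_
    filter_upwards [eventually_ge_atTop (S.sup Int.natAbs + 1)] with N hN
    congr 1
    ext i j
    have hi : (i : ℤ).natAbs ≤ S.sup Int.natAbs := Finset.le_sup i.2
    simp only [Matrix.submatrix_apply, perturbationKernel]
    rw [truncate_eq_of_le a 1 (by omega), truncate_eq_of_le b 0 (by omega),
      truncate_eq_of_le c 1 (by omega)]
  · refine Finset.prod_le_prod (fun i _ => mul_nonneg (freeKernelRowSum_nonneg z)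
      (rowWeight_nonneg _ _ _ i)) fun i _ => ?_
    exact mul_le_mul_of_nonneg_left (rowWeight_truncate_le a b c N i) (freeKernelRowSum_nonneg z)

theorem norm_tsum_minor_sub_one_le {z : ℂ} (hz : ‖z‖ < 1) (h0 : z ≠ 0) {a b c : ℤ → ℂ}
    (h : Summable (rowWeight a b c)) (hD : Summable fun n => ‖b n‖ + ‖1 - a n * c n‖) :
    ‖∑' S : Finset ℤ, ((perturbationKernel a b c z).submatrix (Subtype.val : S → ℤ)
        Subtype.val).det - 1‖
      ≤ (Real.exp (2 * (‖z‖ / ‖1 - z ^ 2‖) * ∑' n, (‖b n‖ + ‖1 - a n * c n‖)) - 1) / 2 :=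
  le_of_tendsto ((tendsto_tsum_minor_truncate hz h).sub_const 1).norm
    (Eventually.of_forall (norm_tsum_minor_truncate_sub_one_le hz h0 a b c hD))

/-! ### Trace class operators -/

section TraceClass

variable {H : Type*} [NormedAddCommGroup H] [InnerProductSpace ℂ H]

theorem IsTraceClass.mul_right [CompleteSpace H] {T : H →L[ℂ] H} (hT : IsTraceClass T)
    (A : H →L[ℂ] H) : IsTraceClass (T * A) := by
  obtain ⟨x, y, hs, hT⟩ := hT
  refine ⟨x, fun n => ContinuousLinearMap.adjoint A (y n), ?_, fun u => ?_⟩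
  · refine (hs.mul_left ‖ContinuousLinearMap.adjoint A‖).of_nonneg_of_le
      (fun n => by positivity) fun n => ?_
    calc ‖x n‖ * ‖ContinuousLinearMap.adjoint A (y n)‖
        ≤ ‖x n‖ * (‖ContinuousLinearMap.adjoint A‖ * ‖y n‖) := by
          gcongr
          exact ContinuousLinearMap.le_opNorm _ _
      _ = _ := by ring
  · simpa only [ContinuousLinearMap.adjoint_inner_left, mul_apply_eq_comp] using hT (A u)

theorem sum_norm_inner_mul_norm_inner_le {ι : Type*} {v w : ι → H} (hv : Orthonormal ℂ v)
    (hw : Orthonormal ℂ w) (x y : H) (F : Finset ι) :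
    ∑ i ∈ F, ‖inner ℂ (v i) x‖ * ‖inner ℂ (w i) y‖ ≤ ‖x‖ * ‖y‖ := by
  refine (Real.sum_mul_le_sqrt_mul_sqrt F _ _).trans ?_
  gcongr
  · exact Real.sqrt_le_iff.2 ⟨norm_nonneg _, hv.sum_inner_products_le x⟩
  · exact Real.sqrt_le_iff.2 ⟨norm_nonneg _, hw.sum_inner_products_le y⟩

/-- The generalised diagonals `⟨v i, T (w i)⟩` of a trace class operator are summable. -/
theorem IsTraceClass.summable_norm_inner {T : H →L[ℂ] H} (hT : IsTraceClass T) {ι : Type*}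
    {v w : ι → H} (hv : Orthonormal ℂ v) (hw : Orthonormal ℂ w) :
    Summable fun i => ‖inner ℂ (v i) (T (w i))‖ := by
  obtain ⟨x, y, hs, hT⟩ := hT
  have hbd : ∀ n i, ‖inner ℂ (v i) (x n)‖ * ‖inner ℂ (w i) (y n)‖ ≤ ‖x n‖ * ‖y n‖ := by
    intro n i
    simpa using sum_norm_inner_mul_norm_inner_le hv hw (x n) (y n) {i}
  have hsum : ∀ i, Summable fun n => ‖inner ℂ (v i) (x n)‖ * ‖inner ℂ (w i) (y n)‖ := fun i =>
    hs.of_nonneg_of_le (fun n => by positivity) fun n => hbd n i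
  refine summable_of_sum_le (c := ∑' n, ‖x n‖ * ‖y n‖) (fun _ => norm_nonneg _) fun F => ?_
  calc ∑ i ∈ F, ‖inner ℂ (v i) (T (w i))‖
      ≤ ∑ i ∈ F, ∑' n, ‖inner ℂ (v i) (x n)‖ * ‖inner ℂ (w i) (y n)‖ := by
        refine Finset.sum_le_sum fun i _ => ?_
        have h1 : HasSum (fun n => inner ℂ (v i) (inner ℂ (y n) (w i) • x n))
            (inner ℂ (v i) (T (w i))) := (innerSL ℂ (v i)).hasSum (hT (w i))
        rw [← h1.tsum_eq]
        refine tsum_of_norm_bounded (hsum i).hasSum fun n => ?_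
        rw [inner_smul_right, norm_mul, norm_inner_symm, mul_comm]
    _ = ∑' n, ∑ i ∈ F, ‖inner ℂ (v i) (x n)‖ * ‖inner ℂ (w i) (y n)‖ :=
        (Summable.tsum_finsetSum fun i _ => hsum i).symm
    _ ≤ ∑' n, ‖x n‖ * ‖y n‖ :=
        Summable.tsum_le_tsum (fun n => sum_norm_inner_mul_norm_inner_le hv hw _ _ F)
          (summable_sum fun i _ => hsum i) hs

end TraceClass

/-! ### The free resolvent -/

theorem norm_weightedShift_one_le (k : ℤ) (hw : ∃ C : ℝ, ∀ _ : ℤ, ‖(1 : ℂ)‖ ≤ C) :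
    ‖weightedShift (fun _ => 1) k hw‖ ≤ 1 := by
  refine ContinuousLinearMap.opNorm_le_bound _ zero_le_one fun u => ?_
  have h2 : 0 < (2 : ENNReal).toReal := by norm_num
  refine lp.norm_le_of_tsum_le h2 (by positivity) ?_
  rw [one_mul, lp.norm_rpow_eq_tsum h2 u,
    ← (Equiv.addRight k).tsum_eq fun n : ℤ => ‖u n‖ ^ (2 : ENNReal).toReal]
  simp

/-- `J₀ - λ(z) = -z⁻¹ (1 - z S) (1 - z S⁻¹)`, where `S` is the shift. -/
theorem isUnit_free_sub_zhukovsky {z : ℂ} (hz : ‖z‖ < 1) (h0 : z ≠ 0) :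
    IsUnit (JacobiMatrix.free.toOp - zhukovsky z • (1 : EllTwo →L[ℂ] EllTwo)) := by
  have hw : ∃ C : ℝ, ∀ _ : ℤ, ‖(1 : ℂ)‖ ≤ C := ⟨1, fun _ => by simp⟩
  have hu : ∀ k : ℤ, IsUnit (1 - z • weightedShift (fun _ => 1) k hw) := fun k => by
    refine isUnit_one_sub_of_norm_lt_one ?_
    rw [norm_smul]
    exact (mul_le_of_le_one_right (norm_nonneg _) (norm_weightedShift_one_le k hw)).trans_lt hz
  have hc : IsUnit (algebraMap ℂ (EllTwo →L[ℂ] EllTwo) (-(1 / z))) :=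
    (IsUnit.mk0 (-(1 / z)) (neg_ne_zero.2 (one_div_ne_zero h0))).map _
  convert (hc.mul (hu 1)).mul (hu (-1)) using 1
  ext u n
  have h1 : (1 / z) * z = 1 := one_div_mul_cancel h0
  simp only [sub_apply, mul_apply_eq_comp,
    smul_apply, one_apply_eq_self, lp.coeFn_sub, lp.coeFn_smul,
    Pi.sub_apply, Pi.smul_apply, JacobiMatrix.toOp_apply, JacobiMatrix.free, smul_eq_mul,
    weightedShift_apply, Algebra.algebraMap_eq_smul_one, zhukovsky, ← sub_eq_add_neg,
    add_sub_cancel_right]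
  linear_combination (-(u (n - 1)) - u (n + 1) + z * u n) * h1

theorem memℓp_freeKernel {z : ℂ} (hz : ‖z‖ < 1) (j : ℤ) :
    Memℓp (fun n : ℤ => freeKernel z n j) 2 := by
  refine memℓp_gen ?_
  have h := ((summable_pow_natAbs (sq_nonneg ‖z‖) (pow_lt_one₀ (norm_nonneg z) hz
    two_ne_zero)).div_const (‖z - 1 / z‖ ^ 2)).comp_injective (Equiv.subRight j).injective
  refine h.congr fun n => ?_
  simp only [Function.comp_apply, Equiv.subRight_apply, freeKernel, norm_div, norm_pow,
    ENNReal.toReal_ofNat, Real.rpow_ofNat, div_pow]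
  rw [← pow_mul, ← pow_mul, mul_comm]

/-- The matrix of the free resolvent in the standard basis is the free kernel. -/
theorem freeResolvent_stdBasis {z : ℂ} (hz : ‖z‖ < 1) (h0 : z ≠ 0) (n j : ℤ) :
    freeResolvent z (stdBasis j) n = freeKernel z n j := by
  have hcol : (JacobiMatrix.free.toOp - zhukovsky z • (1 : EllTwo →L[ℂ] EllTwo))
      (⟨fun n => freeKernel z n j, memℓp_freeKernel hz j⟩ : EllTwo) = stdBasis j := by
    ext i
    simp only [sub_apply, smul_apply,
      one_apply_eq_self, lp.coeFn_sub, lp.coeFn_smul, Pi.sub_apply, Pi.smul_apply,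
      JacobiMatrix.toOp_apply, JacobiMatrix.free, smul_eq_mul]
    rw [stdBasis_apply, lp.single_apply, Pi.single_apply, ← freeKernel_sub_add hz h0 i j]
    ring
  rw [freeResolvent, if_neg h0, ← hcol, ← mul_apply_eq_comp,
    Ring.inverse_mul_cancel _ (isUnit_free_sub_zhukovsky hz h0)]
  rfl

/-! ### The perturbation determinant of a Jacobi matrix -/

namespace JacobiMatrix

variable (J : JacobiMatrix)

theorem sub_free_apply (u : EllTwo) (n : ℤ) :
    (J.toOp - free.toOp) u n
      = (J.a (n - 1) - 1) * u (n - 1) + J.b n * u n + (J.c n - 1) * u (n + 1) := by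
  simp only [sub_apply, lp.coeFn_sub, Pi.sub_apply, toOp_apply, free]
  ring

theorem principalMinor_perturbationOp {z : ℂ} (hz : ‖z‖ < 1) (h0 : z ≠ 0) (S : Finset ℤ) :
    principalMinor stdBasis (J.perturbationOp z) S
      = ((perturbationKernel J.a J.b J.c z).submatrix (Subtype.val : S → ℤ) Subtype.val).det := by
  unfold principalMinor
  congr 1
  ext i j
  rw [Matrix.of_apply, Matrix.submatrix_apply, inner_stdBasis, perturbationOp,
    mul_apply_eq_comp, sub_free_apply]
  simp only [freeResolvent_stdBasis hz h0, perturbationKernel]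

variable {J}

theorem summable_entries (hJ : IsTraceClass (J.toOp - free.toOp)) :
    (Summable fun n => ‖J.a n - 1‖) ∧ (Summable fun n => ‖J.b n‖) ∧
      Summable fun n => ‖J.c n - 1‖ := by
  have ho := stdBasis.orthonormal
  have key : ∀ k : ℤ, Summable fun n => ‖(J.toOp - free.toOp) (stdBasis (n + k)) n‖ := by
    intro k
    simpa only [Function.comp_apply, inner_stdBasis] using
      hJ.summable_norm_inner ho (ho.comp (fun n => n + k) (add_left_injective k))
  have hs : ∀ i n : ℤ, stdBasis i n = if n = i then 1 else 0 := fun i n => by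
    rw [stdBasis_apply, lp.single_apply, Pi.single_apply]
  refine ⟨?_, ?_, ?_⟩
  · refine ((Equiv.addRight (1 : ℤ)).summable_iff.2 (key (-1))).congr fun n => ?_
    simp only [Function.comp_apply, Equiv.coe_addRight, sub_free_apply, hs]
    simp [show n + 1 + 1 ≠ n by omega]
  · refine (key 0).congr fun n => ?_
    simp only [sub_free_apply, hs]
    simp
  · refine (key 1).congr fun n => ?_
    simp only [sub_free_apply, hs]
    simp [show n - 1 ≠ n + 1 by omega]

theorem summable_rowWeight (hJ : IsTraceClass (J.toOp - free.toOp)) :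
    Summable (rowWeight J.a J.b J.c) := by
  obtain ⟨ha, hb, hc⟩ := summable_entries hJ
  exact (((Equiv.subRight (1 : ℤ)).summable_iff.2 ha).add hb).add hc

theorem summable_deltaTerm (hJ : IsTraceClass (J.toOp - free.toOp)) : Summable J.deltaTerm := by
  obtain ⟨ha, hb, hc⟩ := summable_entries hJ
  obtain ⟨C, hC⟩ := J.bounded_a
  -- `a c - 1 = (a - 1) + a (c - 1)`, and `a` is bounded.
  refine hb.add ((ha.add (hc.mul_left C)).of_nonneg_of_le (fun n => norm_nonneg _) fun n => ?_)
  calc ‖1 - J.a n * J.c n‖ = ‖(J.a n - 1) + J.a n * (J.c n - 1)‖ := by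
        rw [norm_sub_rev]; congr 1; ring
    _ ≤ ‖J.a n - 1‖ + ‖J.a n‖ * ‖J.c n - 1‖ := by
        rw [← norm_mul]; exact norm_add_le _ _
    _ ≤ _ := by gcongr; exact hC n

theorem delta_nonneg (J : JacobiMatrix) : 0 ≤ J.delta :=
  tsum_nonneg fun n => by unfold deltaTerm; positivity

theorem xBound_nonneg (J : JacobiMatrix) (z : ℂ) : 0 ≤ J.xBound z := by
  have := J.delta_nonneg
  unfold xBound
  positivity

@[simp]
theorem perturbationOp_zero (J : JacobiMatrix) : J.perturbationOp 0 = 0 := by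
  simp [perturbationOp, freeResolvent]

theorem principalMinor_perturbationOp_zero (J : JacobiMatrix) {S : Finset ℤ} (hS : S ≠ ∅) :
    principalMinor stdBasis (J.perturbationOp 0) S = 0 := by
  obtain ⟨i, hi⟩ := Finset.nonempty_iff_ne_empty.2 hS
  exact Matrix.det_eq_zero_of_row_eq_zero ⟨i, hi⟩ fun j => by simp

theorem perturbationDet_zero (J : JacobiMatrix) : J.perturbationDet 0 = 1 := by
  rw [perturbationDet, fredholmDet,
    tsum_eq_single ∅ fun S hS => J.principalMinor_perturbationOp_zero hS]
  exact Matrix.det_isEmpty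

theorem summable_principalMinor (hJ : IsTraceClass (J.toOp - free.toOp)) {z : ℂ} (hz : ‖z‖ < 1) :
    Summable (principalMinor stdBasis (J.perturbationOp z)) := by
  by_cases h0 : z = 0
  · subst h0
    exact summable_of_ne_finset_zero (s := {∅}) fun S hS =>
      J.principalMinor_perturbationOp_zero (by simpa using hS)
  · exact (summable_minor_perturbationKernel hz (summable_rowWeight hJ)).congr fun S =>
      (J.principalMinor_perturbationOp hz h0 S).symm

/-- The bound behind all the estimates; it is stronger than the stated ones, since the summand
`√Δ` of `J.xBound z` is not needed. -/
theorem norm_perturbationDet_sub_one_le (hJ : IsTraceClass (J.toOp - free.toOp)) {z : ℂ}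
    (hz : ‖z‖ < 1) : ‖J.perturbationDet z - 1‖ ≤ (Real.exp (J.xBound z) - 1) / 2 := by
  by_cases h0 : z = 0
  · subst h0
    have := Real.one_le_exp (J.xBound_nonneg 0)
    rw [perturbationDet_zero, sub_self, norm_zero]
    linarith
  · rw [perturbationDet, fredholmDet,
      tsum_congr fun S => J.principalMinor_perturbationOp hz h0 S]
    refine (norm_tsum_minor_sub_one_le hz h0 (summable_rowWeight hJ)
      (summable_deltaTerm hJ)).trans ?_
    have hd : ∑' n, (‖J.b n‖ + ‖1 - J.a n * J.c n‖) = J.delta := rfl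
    have h1 : 2 * (‖z‖ / ‖1 - z ^ 2‖) * J.delta ≤ J.xBound z := by
      rw [xBound, ← mul_div_assoc]
      exact mul_le_mul_of_nonneg_left (le_add_of_nonneg_left (Real.sqrt_nonneg _)) (by positivity)
    rw [hd]
    gcongr

theorem tendsto_perturbationDet (hJ : IsTraceClass (J.toOp - free.toOp)) :
    Tendsto J.perturbationDet (𝓝[≠] 0) (𝓝 1) := by
  have hx : Tendsto (fun z => (Real.exp (J.xBound z) - 1) / 2) (𝓝 0) (𝓝 0) := by
    have hc : ContinuousAt (fun z => (Real.exp (J.xBound z) - 1) / 2) 0 := by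
      unfold xBound
      have : ‖1 - (0 : ℂ) ^ 2‖ ≠ 0 := by simp
      fun_prop (disch := assumption)
    simpa [ContinuousAt, xBound] using hc
  rw [tendsto_iff_norm_sub_tendsto_zero]
  refine squeeze_zero' (Eventually.of_forall fun _ => norm_nonneg _) ?_
    (hx.mono_left nhdsWithin_le_nhds)
  filter_upwards [nhdsWithin_le_nhds (Metric.ball_mem_nhds (0 : ℂ) one_pos)] with z hz
  exact norm_perturbationDet_sub_one_le hJ (by simpa using hz)

end JacobiMatrix

/-! ### The estimates in the stated form -/

theorem exp_sub_one_half_le {x : ℝ} (hx : 0 ≤ x) :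
    (Real.exp x - 1) / 2 ≤ (4 * x + 5 * x ^ 2) * Real.exp (4 * x) := by
  have h1 : Real.exp x - 1 ≤ x * Real.exp x := by
    have h := mul_le_mul_of_nonneg_left (Real.one_sub_le_exp_neg x) (Real.exp_pos x).le
    rw [← Real.exp_add, add_neg_cancel, Real.exp_zero] at h
    linarith
  have h2 : x * Real.exp x ≤ (4 * x + 5 * x ^ 2) * Real.exp (4 * x) := by
    gcongr <;> nlinarith
  have h3 : 0 ≤ x * Real.exp x := by positivity
  linarith

theorem one_add_mul_exp_le {x : ℝ} (hx : 0 ≤ x) :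
    (1 + 4 * x + 5 * x ^ 2) * Real.exp (4 * x) ≤ Real.exp (8 * x) := by
  rw [show 8 * x = 4 * x + 4 * x by ring, Real.exp_add]
  gcongr
  have := Real.quadratic_le_exp_of_nonneg (show 0 ≤ 4 * x by positivity)
  nlinarith [sq_nonneg x]

theorem mainTheorem2 (J : JacobiMatrix)
    (hJ : IsTraceClass (J.toOp - JacobiMatrix.free.toOp)) :
    Summable J.deltaTerm ∧
    (∀ z : ℂ, ‖z‖ < 1 → z ≠ 0 →
      IsUnit (JacobiMatrix.free.toOp - zhukovsky z • (1 : EllTwo →L[ℂ] EllTwo))) ∧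
    (∀ z : ℂ, ‖z‖ < 1 →
      IsTraceClass (J.perturbationOp z) ∧
      Summable (principalMinor stdBasis (J.perturbationOp z))) ∧
    (∀ z : ℂ, ‖z‖ < 1 →
      ‖J.perturbationDet z - 1‖
          ≤ (4 * J.xBound z + 5 * J.xBound z ^ 2) * Real.exp (4 * J.xBound z) ∧
      ‖J.perturbationDet z‖
          ≤ (1 + 4 * J.xBound z + 5 * J.xBound z ^ 2) * Real.exp (4 * J.xBound z) ∧
      (1 + 4 * J.xBound z + 5 * J.xBound z ^ 2) * Real.exp (4 * J.xBound z)
          ≤ Real.exp (8 * J.xBound z) ∧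
      Real.log ‖J.perturbationDet z‖
          ≤ 16 * ‖z‖ / ‖1 - z ^ 2‖ * (√J.delta + J.delta)) ∧
    J.perturbationDet 0 = 1 ∧
    Tendsto J.perturbationDet (𝓝[≠] 0) (𝓝 1) := by
  refine ⟨JacobiMatrix.summable_deltaTerm hJ, fun z hz h0 => isUnit_free_sub_zhukovsky hz h0,
    fun z hz => ⟨hJ.mul_right _, JacobiMatrix.summable_principalMinor hJ hz⟩, fun z hz => ?_,
    J.perturbationDet_zero, JacobiMatrix.tendsto_perturbationDet hJ⟩
  have hx := J.xBound_nonneg z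
  have h1 := (JacobiMatrix.norm_perturbationDet_sub_one_le hJ hz).trans (exp_sub_one_half_le hx)
  have h2 : ‖J.perturbationDet z‖
      ≤ (1 + 4 * J.xBound z + 5 * J.xBound z ^ 2) * Real.exp (4 * J.xBound z) := by
    have h3 := norm_le_norm_sub_add (J.perturbationDet z) 1
    have h4 := Real.one_le_exp (show 0 ≤ 4 * J.xBound z by positivity)
    rw [norm_one] at h3
    linarith
  have h3 := one_add_mul_exp_le hx
  refine ⟨h1, h2, h3, ?_⟩
  have h5 : 16 * ‖z‖ / ‖1 - z ^ 2‖ * (√J.delta + J.delta) = 8 * J.xBound z := by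
    rw [JacobiMatrix.xBound]; ring
  rw [h5]
  by_cases hL : J.perturbationDet z = 0
  -- `Real.log 0 = 0`, and the right-hand side is nonnegative.
  · rw [hL, norm_zero, Real.log_zero]
    positivity
  · exact (Real.log_le_iff_le_exp (norm_pos_iff.2 hL)).2 (h2.trans h3)
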